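/- Let $X$ be an affine algebraic manifold, i.e. a smooth (not necessarily connected) closed affine algebraic subvariety of some $\mathbb{C}^n$, with algebra of regular functions $\mathbb{C}[X]$, and let $\mathrm{Aut}\,X$ be its group of algebraic automorphisms. Let $\mathrm{VF}_{alg}(X)$ be the $\mathbb{C}[X]$-module and complex Lie algebra of all algebraic vector fields on $X$ (the $\mathbb{C}$-linear derivations of $\mathbb{C}[X]$). Call an algebraic vector field $\delta$ completely integrable if its flow exists for all complex times, i.e. for every $x\in X$ there is a holomorphic curve $\gamma:\mathbb{C}\to X$ with $\gamma(0)=x$ and $\gamma'(t)=\delta(\gamma(t))$ for all $t\in\mathbb{C}$. Let $\mathrm{Lie}_{alg}(X)\subset \mathrm{VF}_{alg}(X)$ be the complex Lie subalgebra generated by the completely integrable algebraic vector fields; $X$ has the algebraic density property if $\mathrm{Lie}_{alg}(X)=\mathrm{VF}_{alg}(X)$. For $x\in X$, a finite subset $M\subset T_{x}X$ is called a generating set if the vectors $d\alpha_{x}(v)$, with $v\in M$ and $\alpha\in\mathrm{Aut}\,X$ such that $\alpha(x)=x$, span the vector space $T_{x}X$. Theorem. Suppose that $\mathrm{Aut}\,X$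 acts transitively on $X$. Let $L$ be a $\mathbb{C}[X]$-submodule of $\mathrm{VF}_{alg}(X)$ such that $L\subset\mathrm{Lie}_{alg}(X)$. Suppose that for some $x_0\in X$ the fiber $\{\delta(x_0):\delta\in L\}\subset T_{x_0}X$ of $L$ over $x_0$ contains a generating set. Then $X$ has the algebraic density property. -/

import Mathlib

noncomputable section

namespace AffineADP

variable {n : ℕ}

/-- The algebra `ℂ[X]` of regular functions on a subset `X ⊆ ℂⁿ`: the functions `X → ℂ` that are
restrictions of polynomials. -/
def regularFunctions (X : Set (Fin n → ℂ)) : Subalgebra ℂ (X → ℂ) :=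
  (MvPolynomial.aeval (fun (i : Fin n) (x : X) => (x : Fin n → ℂ) i)).range

/-- `X ⊆ ℂⁿ` is an affine algebraic manifold: it is the common zero set of an ideal of polynomials,
and it is smooth, i.e. its algebra of regular functions is a smooth `ℂ`-algebra.
It is not required to be connected. -/
structure IsAffineManifold (X : Set (Fin n → ℂ)) : Prop where
  algebraic : ∃ I : Ideal (MvPolynomial (Fin n) ℂ), X = MvPolynomial.zeroLocus ℂ I
  smooth : Algebra.Smooth ℂ (regularFunctions X)

/-- The algebraic vector fields `VF_alg(X)`, as the `ℂ`-linear derivations of `ℂ[X]`.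
Mathlib provides the `ℂ[X]`-module structure and the Lie bracket. -/
abbrev VectorField (X : Set (Fin n → ℂ)) : Type :=
  Derivation ℂ (regularFunctions X) (regularFunctions X)

variable {X : Set (Fin n → ℂ)}

/-- An algebraic vector field is completely integrable if its flow exists for all complex times:
through every point `x` of `X` there is an entire curve `γ : ℂ → X` with `γ 0 = x` and
`γ' (t) = δ (γ t)`. The differential equation is tested on all regular functions; applied to the
coordinate functions it says that `γ` is holomorphic as a curve in `ℂⁿ` and solves the equation. -/
def IsCompletelyIntegrable (δ : VectorField X) : Prop :=
  ∀ x : X, ∃ γ : ℂ → X, γ 0 = x ∧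
    ∀ (f : regularFunctions X) (t : ℂ),
      HasDerivAt (fun s : ℂ => f.1 (γ s)) ((δ f).1 (γ t)) t

/-- `Lie_alg(X)`: the complex Lie algebra generated by the completely integrable algebraic vector
fields. -/
def lieAlg (X : Set (Fin n → ℂ)) : LieSubalgebra ℂ (VectorField X) :=
  LieSubalgebra.lieSpan ℂ (VectorField X) {δ | IsCompletelyIntegrable δ}

/-- The algebraic density property: `Lie_alg(X) = VF_alg(X)`. -/
def HasAlgebraicDensityProperty (X : Set (Fin n → ℂ)) : Prop :=
  lieAlg X = ⊤

/-- `Aut X`: the bijections `σ` of `X` such that `σ` and `σ⁻¹` are morphisms, i.e. pull regular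
functions back to regular functions. As a group of permutations it acts on `X`. -/
def algAut (X : Set (Fin n → ℂ)) : Subgroup (Equiv.Perm X) where
  carrier := {σ | (∀ f ∈ regularFunctions X, f ∘ σ ∈ regularFunctions X) ∧
    ∀ f ∈ regularFunctions X, f ∘ σ.symm ∈ regularFunctions X}
  one_mem' := ⟨fun _ hf => hf, fun _ hf => hf⟩
  mul_mem' {a b} ha hb :=
    ⟨fun f hf => hb.1 (f ∘ a) (ha.1 f hf), fun f hf => ha.2 (f ∘ b.symm) (hb.2 f hf)⟩
  inv_mem' {_} ha := ⟨ha.2, ha.1⟩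

/-- `X` is homogeneous: `Aut X` acts transitively on `X`. -/
def IsHomogeneous (X : Set (Fin n → ℂ)) : Prop :=
  ∀ x y : X, ∃ σ : algAut X, σ • x = y

/-- The tangent space `T_x X`: the point derivations of `ℂ[X]` at `x`. -/
def tangentSpace (x : X) : Submodule ℂ (regularFunctions X →ₗ[ℂ] ℂ) where
  carrier := {v | ∀ f g : regularFunctions X, v (f * g) = f.1 x * v g + g.1 x * v f}
  zero_mem' := by intro f g; simp
  add_mem' := by
    intro v w hv hw f g
    rw [LinearMap.add_apply, LinearMap.add_apply, LinearMap.add_apply, hv f g, hw f g]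
    ring
  smul_mem' := by
    intro c v hv f g
    rw [LinearMap.smul_apply, LinearMap.smul_apply, LinearMap.smul_apply, hv f g]
    simp only [smul_eq_mul]
    ring

/-- The value `δ(x) ∈ T_x X` of an algebraic vector field at a point, `f ↦ (δ f)(x)`. -/
def valueAt (x : X) : VectorField X →ₗ[ℂ] tangentSpace x where
  toFun δ :=
    ⟨{ toFun := fun f => (δ f).1 x
       map_add' := fun f g => by rw [map_add]; rfl
       map_smul' := fun c f => by rw [Derivation.map_smul]; rfl },
     fun f g => by
      change (δ (f * g)).1 x = f.1 x * (δ g).1 x + g.1 x * (δ f).1 x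
      rw [Derivation.leibniz]; rfl⟩
  map_add' _ _ := rfl
  map_smul' _ _ := rfl

/-- The pullback `f ↦ f ∘ σ` of regular functions along an automorphism. -/
def pullback (σ : algAut X) : regularFunctions X →ₗ[ℂ] regularFunctions X where
  toFun f := ⟨f.1 ∘ σ.1, σ.2.1 f.1 f.2⟩
  map_add' _ _ := rfl
  map_smul' _ _ := rfl

/-- The isotropy action on `T_x X`: an automorphism `σ` with `σ x = x` acts by its differential
`v ↦ (f ↦ v (f ∘ σ))`. -/
def isotropyAction (x : X) (σ : MulAction.stabilizer (algAut X) x) :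
    tangentSpace x →ₗ[ℂ] tangentSpace x where
  toFun v := ⟨v.1 ∘ₗ pullback σ.1, fun f g => by
    have hσ : σ.1.1 x = x := σ.2
    have h := v.2 (pullback σ.1 f) (pullback σ.1 g)
    change v.1 (pullback σ.1 f * pullback σ.1 g) =
      f.1 (σ.1.1 x) * v.1 (pullback σ.1 g) + g.1 (σ.1.1 x) * v.1 (pullback σ.1 f) at h
    rw [hσ] at h
    exact h⟩
  map_add' _ _ := rfl
  map_smul' _ _ := rfl

/-- A finite set `M` of tangent vectors at `x` is a generating set if the images of its elements
under the isotropy group of `x` span `T_x X`. -/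
def IsGeneratingSet (x : X) (M : Set (tangentSpace x)) : Prop :=
  M.Finite ∧
    Submodule.span ℂ
      {w | ∃ σ : MulAction.stabilizer (algAut X) x, ∃ v ∈ M, isotropyAction x σ v = w} = ⊤

/-- The fiber over `x` of a `ℂ[X]`-module `L` of algebraic vector fields: the set of values `δ(x)`
for `δ ∈ L`. -/
def fiber (L : Submodule (regularFunctions X) (VectorField X)) (x : X) : Set (tangentSpace x) :=
  valueAt x '' L

end AffineADP

end

open scoped KaehlerDifferential

noncomputable section


/-! Automorphisms carry complete flows to complete flows, so pushforward preserves `lieAlg X`, and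
also `lieAlgCore X`, the largest module inside it, which contains `L`. The fiber of the core at `x₀`
is thus a subspace stable under isotropy; it contains a generating set, so it is all of the tangent
space. By homogeneity the core attains the value of every field at every point `y`. The difference
of two fields agreeing at `y` takes values in the maximal ideal of `y`, and smoothness (projective
`Ω`) puts it in that ideal times `VectorField X`. Nakayama at all maximal ideals, which are points
by the Nullstellensatz, makes the core everything. -/

/-- If `Ω[A⁄R]` is finite projective, a derivation of `A` with values in an ideal `I` belongs to
`I • Der_R(A)`. -/
theorem Derivation.mem_ideal_smul_top {R A : Type*} [CommRing R] [CommRing A] [Algebra R A]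
    [Module.Finite A Ω[A⁄R]] [Module.Projective A Ω[A⁄R]] (I : Ideal A) (D : Derivation R A A)
    (hD : ∀ a, D a ∈ I) : D ∈ I • (⊤ : Submodule A (Derivation R A A)) := by
  -- `Ω` is a direct summand of `A^m`; the images under `f` of the unit vectors and the coordinates
  -- of `g` form a dual basis.
  obtain ⟨m, f, g, -, -, hfg⟩ := Module.Finite.exists_comp_eq_id_of_projective A Ω[A⁄R]
  have hI : ∀ w, D.liftKaehlerDifferential w ∈ I := by
    intro w
    have hw : w ∈ Submodule.span A (Set.range (KaehlerDifferential.D R A)) := by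
      rw [KaehlerDifferential.span_range_derivation]; trivial
    induction hw using Submodule.span_induction with
    | mem x hx =>
      obtain ⟨a, rfl⟩ := hx
      rw [Derivation.liftKaehlerDifferential_comp_D]
      exact hD a
    | zero => simp
    | add x y _ _ hx hy => rw [map_add]; exact I.add_mem hx hy
    | smul a x _ hx =>
      have h : D.liftKaehlerDifferential (a • x) = a • D.liftKaehlerDifferential x :=
        D.liftKaehlerDifferential.map_smul a x
      rw [h]
      exact I.mul_mem_left a hx
  have hlift : ∀ w, D.liftKaehlerDifferential w =
      ∑ i, D.liftKaehlerDifferential (f (Pi.single i 1)) * g w i := by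
    intro w
    have h : ∀ v : Fin m → A, (D.liftKaehlerDifferential ∘ₗ f) v =
        ∑ i, (D.liftKaehlerDifferential ∘ₗ f) (Pi.single i 1) * v i := fun v => by
      rw [LinearMap.pi_apply_eq_sum_univ]
      refine Finset.sum_congr rfl fun i _ => ?_
      rw [smul_eq_mul, mul_comm]
      congr 3
      ext j
      simp [Pi.single_apply, eq_comm]
    have hw : f (g w) = w := LinearMap.congr_fun hfg w
    have hgw : D.liftKaehlerDifferential (f (g w)) = _ := h (g w)
    rwa [hw] at hgw
  have hsum : D = ∑ i, D.liftKaehlerDifferential (f (Pi.single i 1)) •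
      KaehlerDifferential.linearMapEquivDerivation R A ((LinearMap.proj i).comp g) := by
    ext a
    rw [← D.liftKaehlerDifferential_comp_D a, hlift]
    change _ = Derivation.coeFnAddMonoidHom (∑ i, _) a
    rw [map_sum, Finset.sum_apply]
    rfl
  rw [hsum]
  exact Submodule.sum_mem _ fun i _ => Submodule.smul_mem_smul (hI _) trivial

theorem Derivation.module_finite (R A : Type*) [CommRing R] [CommRing A] [Algebra R A]
    [Module.Finite A Ω[A⁄R]] [Module.Projective A Ω[A⁄R]] :
    Module.Finite A (Derivation R A A) :=
  have : Module.Finite A (Ω[A⁄R] →ₗ[A] A) :=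
    inferInstanceAs (Module.Finite A (Module.Dual A Ω[A⁄R]))
  Module.Finite.equiv (KaehlerDifferential.linearMapEquivDerivation (M := A) R A)

/-- Nakayama's lemma over all maximal ideals: a submodule `N` of a finite module `M` with
`M = N + 𝔪 M` for every maximal ideal `𝔪` is all of `M`. -/
theorem Submodule.eq_top_of_forall_isMaximal_le_sup {A M : Type*} [CommRing A] [AddCommGroup M]
    [Module A M] [Module.Finite A M] (N : Submodule A M)
    (h : ∀ m : Ideal A, m.IsMaximal → ⊤ ≤ N ⊔ m • (⊤ : Submodule A M)) : N = ⊤ := by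
  -- If `J` lay in a maximal `m`, Nakayama would give `r ≡ 1` mod `m` with `r M ⊆ N`, so `r ∈ J ⊆ m`
  -- and `1 ∈ m`.
  let J : Ideal A := N.colon Set.univ
  by_contra hN
  have hJ : J ≠ ⊤ := by
    intro hJ
    have h1 : (1 : A) ∈ J := hJ ▸ trivial
    refine hN (eq_top_iff.2 fun x _ => ?_)
    simpa using Submodule.mem_colon.1 h1 x trivial
  obtain ⟨m, hm, hle⟩ := J.exists_le_maximal hJ
  obtain ⟨r, hr, hrN⟩ := Submodule.exists_sub_one_mem_and_smul_le_of_fg_of_le_sup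
    (Module.Finite.fg_top (R := A) (M := M)) le_top (h m hm)
  have hrJ : r ∈ J := Submodule.mem_colon.2 fun x _ =>
    hrN (Submodule.smul_mem_pointwise_smul x r ⊤ trivial)
  exact hm.ne_top ((Ideal.eq_top_iff_one m).2 (by simpa using m.sub_mem (hle hrJ) hr))

namespace AffineADP

variable {n : ℕ} {X : Set (Fin n → ℂ)}

/-- The pushforward `σ_* δ : f ↦ δ (f ∘ σ) ∘ σ⁻¹` of vector fields along an automorphism. -/
def pushforward (σ : algAut X) : VectorField X →ₗ⁅ℂ⁆ VectorField X where
  toFun δ :=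
    { toLinearMap := pullback σ⁻¹ ∘ₗ δ.toLinearMap ∘ₗ pullback σ
      map_one_eq_zero' := by
        change pullback σ⁻¹ (δ 1) = 0
        rw [Derivation.map_one_eq_zero, map_zero]
      leibniz' := fun f g => by
        change pullback σ⁻¹ (δ (pullback σ f * pullback σ g)) = _
        rw [Derivation.leibniz, map_add]
        ext x
        change (f.1 (σ.1 (σ.1.symm x))) * _ + (g.1 (σ.1 (σ.1.symm x))) * _ = _
        rw [Equiv.apply_symm_apply]
        rfl }
  map_add' δ ε := by ext f x; rfl
  map_smul' c δ := by ext f x; rfl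
  map_lie' {δ ε} := by
    have h : ∀ f, pullback σ (pullback σ⁻¹ f) = f := fun f => by
      ext x
      exact congrArg f.1 (σ.1.symm_apply_apply x)
    ext f : 1
    change pullback σ⁻¹ (δ (ε (pullback σ f)) - ε (δ (pullback σ f))) =
      pullback σ⁻¹ (δ (pullback σ (pullback σ⁻¹ (ε (pullback σ f))))) -
      pullback σ⁻¹ (ε (pullback σ (pullback σ⁻¹ (δ (pullback σ f)))))
    rw [h, h, map_sub]

theorem pushforward_apply (σ : algAut X) (δ : VectorField X) (f : regularFunctions X) (x : X) :
    (pushforward σ δ f).1 x = (δ (pullback σ f)).1 (σ.1.symm x) := rfl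

/-- Semilinearity over `pullback σ` is what makes the core, and not only `lieAlg X`, invariant under
automorphisms. -/
theorem smul_pushforward (σ : algAut X) (a : regularFunctions X) (δ : VectorField X) :
    a • pushforward σ δ = pushforward σ (pullback σ a • δ) := by
  ext f x
  change a.1 x * _ = a.1 (σ.1 (σ.1.symm x)) * _
  rw [Equiv.apply_symm_apply]
  rfl

theorem IsCompletelyIntegrable.pushforward {δ : VectorField X} (h : IsCompletelyIntegrable δ)
    (σ : algAut X) : IsCompletelyIntegrable (pushforward σ δ) := by
  intro x
  obtain ⟨γ, h0, hγ⟩ := h (σ.1.symm x)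
  -- The integral curves of the pushforward are the images under `σ` of those of `δ`.
  refine ⟨fun t => σ.1 (γ t), by simp [h0], fun f t => ?_⟩
  rw [pushforward_apply, Equiv.symm_apply_apply]
  exact hγ (pullback σ f) t

theorem pushforward_mem_lieAlg (σ : algAut X) {δ : VectorField X} (h : δ ∈ lieAlg X) :
    pushforward σ δ ∈ lieAlg X := by
  have hle : lieAlg X ≤ (lieAlg X).comap (pushforward σ) :=
    LieSubalgebra.lieSpan_le.2 fun ε hε =>
      LieSubalgebra.subset_lieSpan (IsCompletelyIntegrable.pushforward hε σ)
  exact hle h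

/-- The largest `ℂ[X]`-submodule of `VF_alg(X)` contained in `Lie_alg(X)`. -/
def lieAlgCore (X : Set (Fin n → ℂ)) : Submodule (regularFunctions X) (VectorField X) where
  carrier := {δ | ∀ a : regularFunctions X, a • δ ∈ lieAlg X}
  zero_mem' a := by rw [smul_zero]; exact zero_mem _
  add_mem' hδ hε a := by rw [smul_add]; exact add_mem (hδ a) (hε a)
  smul_mem' b δ hδ a := by rw [smul_smul]; exact hδ (a * b)

theorem mem_lieAlg_of_mem_lieAlgCore {δ : VectorField X} (h : δ ∈ lieAlgCore X) :
    δ ∈ lieAlg X := by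
  simpa using h 1

theorem le_lieAlgCore {L : Submodule (regularFunctions X) (VectorField X)}
    (hL : ∀ δ ∈ L, δ ∈ lieAlg X) : L ≤ lieAlgCore X :=
  fun _ hδ a => hL _ (L.smul_mem a hδ)

theorem pushforward_mem_lieAlgCore (σ : algAut X) {δ : VectorField X} (h : δ ∈ lieAlgCore X) :
    pushforward σ δ ∈ lieAlgCore X := fun a => by
  rw [smul_pushforward]
  exact pushforward_mem_lieAlg σ (h _)

/-- For `σ` fixing `x`, the differential of `σ` sends `δ(x)` to the value at `x` of `pushforward σ
δ`. -/
theorem fiber_lieAlgCore_eq_univ_of_isGeneratingSet {x : X} {M : Set (tangentSpace x)}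
    (hM : IsGeneratingSet x M) (hMf : M ⊆ fiber (lieAlgCore X) x) :
    fiber (lieAlgCore X) x = Set.univ := by
  have htop : ((lieAlgCore X).restrictScalars ℂ).map (valueAt x) = ⊤ := by
    rw [eq_top_iff, ← hM.2, Submodule.span_le]
    rintro w ⟨σ, v, hv, rfl⟩
    obtain ⟨δ, hδ, rfl⟩ := hMf hv
    refine ⟨pushforward σ.1 δ, pushforward_mem_lieAlgCore σ.1 hδ, ?_⟩
    have hσ : σ.1.1.symm x = x := (Equiv.symm_apply_eq _).2 (Eq.symm σ.2)
    ext f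
    change (δ (pullback σ.1 f)).1 (σ.1.1.symm x) = (δ (pullback σ.1 f)).1 x
    rw [hσ]
  exact congrArg (fun S : Submodule ℂ (tangentSpace x) => (S : Set (tangentSpace x))) htop

/-- If the core of `Lie_alg(X)` fills the tangent space at one point of a homogeneous `X`, then it
takes the same value as any given vector field at any given point. -/
theorem exists_mem_lieAlgCore_eq_at (hhom : IsHomogeneous X) {x : X}
    (hx : fiber (lieAlgCore X) x = Set.univ) (y : X) (δ : VectorField X) :
    ∃ ε ∈ lieAlgCore X, ∀ f, (ε f).1 y = (δ f).1 y := by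
  obtain ⟨σ, hσ⟩ := hhom x y
  have hσ' : σ.1 x = y := hσ
  -- Pull `δ` back to `x`, match its value there, and push the match forward to `y`.
  obtain ⟨ε, hε, hεx⟩ : valueAt x (pushforward σ⁻¹ δ) ∈ fiber (lieAlgCore X) x := hx ▸ trivial
  refine ⟨pushforward σ ε, pushforward_mem_lieAlgCore σ hε, fun f => ?_⟩
  have h : (ε (pullback σ f)).1 x = (δ (pullback σ⁻¹ (pullback σ f))).1 (σ.1 x) :=
    congrArg (fun v : tangentSpace x => v.1 (pullback σ f)) hεx
  have hf : pullback σ⁻¹ (pullback σ f) = f := by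
    ext z
    exact congrArg f.1 (σ.1.apply_symm_apply z)
  rw [pushforward_apply, ← hσ', Equiv.symm_apply_apply, h, hf]

/-- The weak Nullstellensatz on a closed algebraic subset: the maximal ideals of `ℂ[X]` are the
ideals of points. -/
theorem exists_mem_iff_eval_eq_zero_of_isMaximal
    (hX : ∃ I : Ideal (MvPolynomial (Fin n) ℂ), X = MvPolynomial.zeroLocus ℂ I)
    (m : Ideal (regularFunctions X)) (hm : m.IsMaximal) :
    ∃ x : X, ∀ f, f ∈ m ↔ f.1 x = 0 := by
  obtain ⟨I, hI⟩ := hX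
  let φ : MvPolynomial (Fin n) ℂ →ₐ[ℂ] regularFunctions X :=
    (MvPolynomial.aeval (fun (i : Fin n) (x : X) => (x : Fin n → ℂ) i)).rangeRestrict
  have hφ : Function.Surjective φ := AlgHom.rangeRestrict_surjective _
  have hval : ∀ p (x : X), (φ p).1 x = MvPolynomial.aeval (x : Fin n → ℂ) p := fun p x => by
    have h : (Pi.evalAlgHom ℂ (fun _ : X => ℂ) x).comp
        (MvPolynomial.aeval (fun (i : Fin n) (x : X) => (x : Fin n → ℂ) i)) =
        MvPolynomial.aeval (x : Fin n → ℂ) := by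
      ext i; simp
    exact DFunLike.congr_fun h p
  have hmax : (m.comap φ).IsMaximal := Ideal.comap_isMaximal_of_surjective φ hφ
  obtain ⟨y, hy⟩ := MvPolynomial.isMaximal_iff_eq_vanishingIdeal_singleton.1 hmax
  have hmem : ∀ p, φ p ∈ m ↔ MvPolynomial.aeval y p = 0 := fun p => by
    rw [← Ideal.mem_comap, hy, MvPolynomial.mem_vanishingIdeal_singleton_iff]
  -- Polynomials of `I` restrict to `0 ∈ m`, so they vanish at `y`.
  have hyX : y ∈ X := by
    rw [hI]
    intro p hp
    have h0 : φ p = 0 := by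
      ext x
      rw [hval]
      exact (hI ▸ x.2 : (x : Fin n → ℂ) ∈ MvPolynomial.zeroLocus ℂ I) p hp
    exact (hmem p).1 (h0 ▸ m.zero_mem)
  refine ⟨⟨y, hyX⟩, fun f => ?_⟩
  obtain ⟨p, rfl⟩ := hφ f
  rw [hmem, hval]

end AffineADP

end

theorem theorem2p2 {n : ℕ} (X : Set (Fin n → ℂ))
    (hX : AffineADP.IsAffineManifold X)
    (hhom : AffineADP.IsHomogeneous X)
    (L : Submodule (AffineADP.regularFunctions X) (AffineADP.VectorField X))
    (hL : ∀ δ ∈ L, δ ∈ AffineADP.lieAlg X)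
    (hfib : ∃ (x₀ : X) (M : Set (AffineADP.tangentSpace x₀)),
      AffineADP.IsGeneratingSet x₀ M ∧ M ⊆ AffineADP.fiber L x₀) :
    AffineADP.HasAlgebraicDensityProperty X := by
  obtain ⟨x₀, M, hM, hMf⟩ := hfib
  have hcore := AffineADP.fiber_lieAlgCore_eq_univ_of_isGeneratingSet hM
    (hMf.trans (Set.image_mono (AffineADP.le_lieAlgCore hL)))
  have := hX.smooth
  have : Module.Projective (AffineADP.regularFunctions X) Ω[AffineADP.regularFunctions X⁄ℂ] :=
    Algebra.FormallySmooth.projective_kaehlerDifferential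
  have : Module.Finite (AffineADP.regularFunctions X) (AffineADP.VectorField X) :=
    Derivation.module_finite ℂ (AffineADP.regularFunctions X)
  have htop : AffineADP.lieAlgCore X = ⊤ := by
    refine Submodule.eq_top_of_forall_isMaximal_le_sup (A := AffineADP.regularFunctions X)
      (M := AffineADP.VectorField X) (AffineADP.lieAlgCore X) fun m hm δ _ => ?_
    obtain ⟨y, hy⟩ := AffineADP.exists_mem_iff_eval_eq_zero_of_isMaximal hX.algebraic m hm
    obtain ⟨ε, hε, h⟩ := AffineADP.exists_mem_lieAlgCore_eq_at hhom hcore y δ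
    rw [← add_sub_cancel ε δ]
    refine Submodule.add_mem_sup hε (Derivation.mem_ideal_smul_top m _ fun f => (hy _).2 ?_)
    change (δ f).1 y - (ε f).1 y = 0
    rw [h, sub_self]
  exact eq_top_iff.2 fun δ _ => AffineADP.mem_lieAlg_of_mem_lieAlgCore (htop ▸ trivial)
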